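/- Let $r\ge 0$ be an integer and let $H$ be a finite $r$-uniform hypergraph (no repeated edges; isolated vertices allowed) with at least two edges. The sparseness $s(H)$ is the smallest size of a set $S\subseteq V(H)$ that is contained in exactly one edge of $H$. For $n\ge 0$, an $r$-uniform hypergraph $F$ on an $n$-element vertex set is weakly $H$-saturated if there is a finite sequence $F=F_0\subset F_1\subset\dots\subset F_m=K_n^r$ of hypergraphs on this vertex set, where $K_n^r$ is the complete $r$-uniform hypergraph on it, such that each $F_i$ with $i\ge 1$ is obtained from $F_{i-1}$ by adding one missing edge that creates a new copy of $H$ (a subhypergraph of $F_i$ isomorphic to $H$ and not contained in $F_{i-1}$); $m=0$ is allowed. The weak saturation number $\operatorname{wsat}(n,H)$ is the minimum number of edges of a weakly $H$-saturated $r$-uniform hypergraph on $n$ vertices. Then $s(H)\ge 1$, and there is a constant $C_H>0$ such that \[\operatorname{wsat}(n,H)=C_H\cdot n^{s(H)-1}(1+o(1))\qquad(n\to\infty).\] Moreover, the sequence $\operatorname{wsat}(n,H)\big/\binom{n-|V(H)|}{s(H)-1}$ (defined for all large $n$) converges to a real limit as $n\to\infty$. -/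

import Mathlib

namespace Hypergraph

variable {α β : Type*}

/-- A hypergraph is `r`-uniform if every edge has exactly `r` vertices. -/
def IsUniform (H : Hypergraph α) (r : ℕ) : Prop :=
  ∀ e ∈ H.edgeSet, e.encard = r

/-- `C` is a subhypergraph of `F`. -/
def IsSubhypergraph (C F : Hypergraph α) : Prop :=
  C.vertexSet ⊆ F.vertexSet ∧ C.edgeSet ⊆ F.edgeSet

/-- `C` is an isomorphic copy of `H`: the image of `H` under a map injective on its vertices. -/
def IsCopy (H : Hypergraph α) (C : Hypergraph β) : Prop :=
  ∃ f : α → β, Set.InjOn f H.vertexSet ∧ C = H.image f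

/-- The complete `r`-uniform hypergraph on the vertex set `Fin n`. -/
def completeUniform (n r : ℕ) : Hypergraph (Fin n) where
  vertexSet := Set.univ
  edgeSet := {e | e.encard = r}
  subset_vertexSet_of_mem_edgeSet' := fun e _ => Set.subset_univ e

/-- One step of the `H`-bootstrap percolation process: `F'` is obtained from `F` by adding one
missing edge, and this creates a new copy of `H` (one contained in `F'` but not in `F`). -/
def BootstrapStep (H : Hypergraph α) (F F' : Hypergraph β) : Prop :=
  F'.vertexSet = F.vertexSet ∧
  (∃ e, e ∉ F.edgeSet ∧ F'.edgeSet = insert e F.edgeSet) ∧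
  ∃ C : Hypergraph β, H.IsCopy C ∧ C.IsSubhypergraph F' ∧ ¬ C.IsSubhypergraph F

/-- An `r`-uniform hypergraph `F` on `n` vertices is weakly `H`-saturated if a finite
`H`-bootstrap percolation process leads from `F` to the complete `r`-uniform hypergraph. -/
def IsWeaklySaturated (r : ℕ) (H : Hypergraph α) {n : ℕ} (F : Hypergraph (Fin n)) : Prop :=
  F.vertexSet = Set.univ ∧ F.IsUniform r ∧
    Relation.ReflTransGen (BootstrapStep H) F (completeUniform n r)

/-- The weak saturation number of an `r`-uniform hypergraph `H`: the minimum number of edges of a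
weakly `H`-saturated `r`-uniform hypergraph on `n` vertices. -/
noncomputable def wsat (r n : ℕ) (H : Hypergraph α) : ℕ :=
  sInf {m | ∃ F : Hypergraph (Fin n), IsWeaklySaturated r H F ∧ F.edgeSet.ncard = m}

/-- The sparseness of `H`: the least size of a vertex subset contained in exactly one edge. -/
noncomputable def sparseness (H : Hypergraph α) : ℕ :=
  sInf {k | ∃ S : Set α, S ⊆ H.vertexSet ∧ S.encard = k ∧ ∃! U, U ∈ H.edgeSet ∧ S ⊆ U}

/-- The minimum defining `wsat` is attained. -/
theorem exists_isWeaklySaturated_ncard_eq_wsat (r n : ℕ) (H : Hypergraph α) :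
    ∃ F : Hypergraph (Fin n), IsWeaklySaturated r H F ∧ F.edgeSet.ncard = wsat r n H :=
  Nat.sInf_mem (s := {m | ∃ F : Hypergraph (Fin n), IsWeaklySaturated r H F ∧
    F.edgeSet.ncard = m})
    ⟨_, completeUniform n r, ⟨rfl, fun _ he => he, Relation.ReflTransGen.refl⟩, rfl⟩

/-- The minimum defining the sparseness is attained when `H` is uniform and has an edge. -/
theorem exists_encard_eq_sparseness (r : ℕ) (H : Hypergraph α) (hr : H.IsUniform r)
    (hH : H.edgeSet.Nonempty) :
    ∃ S : Set α, S ⊆ H.vertexSet ∧ S.encard = (sparseness H : ℕ) ∧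
      ∃! U, U ∈ H.edgeSet ∧ S ⊆ U := by
  obtain ⟨e, he⟩ := hH
  refine Nat.sInf_mem (s := {k : ℕ | ∃ S : Set α, S ⊆ H.vertexSet ∧ S.encard = k ∧
    ∃! U, U ∈ H.edgeSet ∧ S ⊆ U})
    ⟨r, e, H.subset_vertexSet_of_mem_edgeSet' he, hr e he, e, ⟨he, subset_rfl⟩, ?_⟩
  rintro U ⟨hU, hs⟩
  have hfin : e.Finite := Set.finite_of_encard_eq_coe (hr e he)
  exact (hfin.eq_of_subset_of_encard_le hs (by rw [hr U hU, hr e he])).symm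

end Hypergraph

/-! Write s = t + 1 for the sparseness and v for the number of vertices of H. Weak saturation
depends only on what the edge set generates under `BootstrapClosure`, so the order of the steps can
be ignored.

Lower bound: a t-subset of an edge of H lies in a second edge, so a t-set inside a generated edge
already lies in an initial one. Initial edges thus cover all t-sets, and wsat is at least
C(n,t)/C(r,t) (`choose_le_wsat_mul_choose`). This makes the limit positive.

Convergence: fix a core of v vertices. An r-set with at least s vertices outside it is generated
from r-sets with fewer (`bootstrapClosure_of_core`), so only those with at most t outer vertices
matter. Place the N outer vertices in a grid of k groups of size q, with q about N/k. Graphs of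
polynomials of degree below t give q^t blocks of size k that cover every set of at most t points in
distinct groups (`exists_transversal_cover`). An optimal system on the core plus each block,
together with all remaining r-sets having at most t outer vertices, generates everything
(`wsat_add_le`). Hence a_N = wsat(v + N)/N^t has limsup at most a_k + D/k for every k, and a Fekete
argument gives the limit. -/

namespace Hypergraph

variable {α β γ : Type*}

/-! ### Order-free form of the bootstrap process -/

/-- The sets obtained from the edge set `E` by running the `H`-bootstrap process to completion. -/
inductive BootstrapClosure (H : Hypergraph α) (E : Set (Set β)) : Set β → Prop
  | base {e : Set β} : e ∈ E → BootstrapClosure H E e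
  | step (f : α → β) (U : Set α) : Set.InjOn f H.vertexSet → U ∈ H.edgeSet →
      (∀ U' ∈ H.edgeSet, U' ≠ U → BootstrapClosure H E (f '' U')) →
      BootstrapClosure H E (f '' U)

theorem BootstrapClosure.trans {H : Hypergraph α} {E E' : Set (Set β)}
    (h : ∀ e ∈ E, BootstrapClosure H E' e) {e : Set β} (he : BootstrapClosure H E e) :
    BootstrapClosure H E' e := by
  induction he with
  | base he => exact h _ he
  | step f U hf hU _ ih => exact .step f U hf hU ih

theorem BootstrapClosure.mono {H : Hypergraph α} {E E' : Set (Set β)} (h : E ⊆ E')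
    {e : Set β} (he : BootstrapClosure H E e) : BootstrapClosure H E' e :=
  he.trans fun _ h' => .base (h h')

theorem BootstrapClosure.image {H : Hypergraph α} {E : Set (Set β)} {g : β → γ}
    (hg : Function.Injective g) {e : Set β} (he : BootstrapClosure H E e) :
    BootstrapClosure H (Set.image g '' E) (g '' e) := by
  induction he with
  | base he => exact .base (Set.mem_image_of_mem _ he)
  | step f U hf hU _ ih =>
    rw [← Set.image_comp]
    refine .step (g ∘ f) U (hg.comp_injOn hf) hU fun U' hU' hne => ?_
    rw [Set.image_comp]
    exact ih U' hU' hne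

/-- A new copy must use the added edge, and injectivity on vertices makes all its other edges old
ones. -/
theorem BootstrapStep.bootstrapClosure {H : Hypergraph α} {F F' : Hypergraph β}
    (h : BootstrapStep H F F') {e : Set β} (he : e ∈ F'.edgeSet) :
    BootstrapClosure H F.edgeSet e := by
  obtain ⟨hV, ⟨e₀, -, hF'⟩, C, ⟨f, hf, rfl⟩, ⟨hCV, hCE⟩, hC⟩ := h
  rw [hF'] at he hCE
  rcases he with rfl | he
  · by_cases hmem : e ∈ (H.image f).edgeSet
    · obtain ⟨U, hU, rfl⟩ := hmem
      refine .step f U hf hU fun U' hU' hne => .base ?_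
      refine (hCE ⟨U', hU', rfl⟩).resolve_left fun heq => hne ?_
      exact (hf.image_eq_image_iff (H.subset_vertexSet_of_mem_edgeSet' hU')
        (H.subset_vertexSet_of_mem_edgeSet' hU)).1 heq
    · refine absurd ⟨hV ▸ hCV, fun e' he' => (hCE he').resolve_left ?_⟩ hC
      rintro rfl
      exact hmem he'
  · exact .base he

theorem bootstrapClosure_of_reflTransGen {H : Hypergraph α} {F F' : Hypergraph β}
    (h : Relation.ReflTransGen (BootstrapStep H) F F') {e : Set β} (he : e ∈ F'.edgeSet) :
    BootstrapClosure H F.edgeSet e := by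
  induction h generalizing e with
  | refl => exact .base he
  | tail _ hstep ih => exact (hstep.bootstrapClosure he).trans fun _ => ih

/-- If every bootstrap step stays inside `E`, then so does the closure. -/
theorem BootstrapClosure.mem_of_closed {H : Hypergraph α} {E : Set (Set β)}
    (hE : ∀ f : α → β, Set.InjOn f H.vertexSet → ∀ U ∈ H.edgeSet,
      (∀ U' ∈ H.edgeSet, U' ≠ U → f '' U' ∈ E) → f '' U ∈ E)
    {e : Set β} (he : BootstrapClosure H E e) : e ∈ E := by
  induction he with
  | base he => exact he
  | step f U hf hU _ ih => exact hE f hf U hU ih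

theorem IsUniform.encard_image {H : Hypergraph α} {r : ℕ} (hH : H.IsUniform r) {f : α → β}
    (hf : Set.InjOn f H.vertexSet) {U : Set α} (hU : U ∈ H.edgeSet) : (f '' U).encard = r := by
  rw [(hf.mono (H.subset_vertexSet_of_mem_edgeSet' hU)).encard_image, hH U hU]

/-- While an `r`-set is missing, the edge set is not closed, so some step adds an edge; the number
of missing sets drops. -/
theorem reflTransGen_completeUniform {H : Hypergraph α} {r n : ℕ} (hH : H.IsUniform r)
    (F : Hypergraph (Fin n)) (hV : F.vertexSet = Set.univ) (hF : F.IsUniform r)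
    (h : ∀ e : Set (Fin n), e.encard = r → BootstrapClosure H F.edgeSet e) :
    Relation.ReflTransGen (BootstrapStep H) F (completeUniform n r) := by
  induction hm : ({e : Set (Fin n) | e.encard = r} \ F.edgeSet).ncard using Nat.strong_induction_on
    generalizing F with
  | _ m ih =>
    by_cases hall : ∀ e : Set (Fin n), e.encard = r → e ∈ F.edgeSet
    · have : F = completeUniform n r :=
        Hypergraph.ext hV (Set.Subset.antisymm (fun e he => hF e he) hall)
      rw [this]
    · have hstep : ∃ f : α → Fin n, Set.InjOn f H.vertexSet ∧ ∃ U ∈ H.edgeSet,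
          (∀ U' ∈ H.edgeSet, U' ≠ U → f '' U' ∈ F.edgeSet) ∧ f '' U ∉ F.edgeSet := by
        by_contra! hcon
        exact hall fun e he => (h e he).mem_of_closed hcon
      obtain ⟨f, hf, U, hU, hother, hnot⟩ := hstep
      let F' : Hypergraph (Fin n) :=
        { vertexSet := Set.univ
          edgeSet := insert (f '' U) F.edgeSet
          subset_vertexSet_of_mem_edgeSet' := fun e _ => Set.subset_univ e }
      have hr := hH.encard_image hf hU
      have h1 : BootstrapStep H F F' := by
        refine ⟨hV.symm, ⟨f '' U, hnot, rfl⟩, H.image f, ⟨f, hf, rfl⟩, ⟨Set.subset_univ _, ?_⟩,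
          fun hC => hnot (hC.2 ⟨U, hU, rfl⟩)⟩
        rintro _ ⟨U', hU', rfl⟩
        by_cases hne : U' = U
        · exact Or.inl (hne ▸ rfl)
        · exact Or.inr (hother U' hU' hne)
      refine .head h1 (ih _ ?_ F' rfl ?_ ?_ rfl)
      · rw [← hm]
        refine Set.ncard_lt_ncard ⟨fun e he => ⟨he.1, fun hc => he.2 (Or.inr hc)⟩, fun hc => ?_⟩
          (Set.toFinite _)
        exact (hc (show f '' U ∈ _ from ⟨hr, hnot⟩)).2 (Or.inl rfl)
      · rintro e (rfl | he)
        exacts [hr, hF e he]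
      · exact fun e he => (h e he).mono (Set.subset_insert _ _)

/-- Allows constructions on any `n`-element type, such as core ⊕ outer vertices. -/
theorem wsat_le_ncard {H : Hypergraph α} {r n : ℕ} (hH : H.IsUniform r) {β : Type*}
    (φ : β ≃ Fin n) (E : Set (Set β)) (hE : ∀ e ∈ E, e.encard = r)
    (h : ∀ e : Set β, e.encard = r → BootstrapClosure H E e) : wsat r n H ≤ E.ncard := by
  let F : Hypergraph (Fin n) :=
    { vertexSet := Set.univ
      edgeSet := Set.image φ '' E
      subset_vertexSet_of_mem_edgeSet' := fun e _ => Set.subset_univ e }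
  have hF : F.IsUniform r := by
    rintro _ ⟨e, he, rfl⟩
    rw [φ.injective.encard_image, hE e he]
  refine Nat.sInf_le ⟨F, ⟨rfl, hF, reflTransGen_completeUniform hH F rfl hF fun e he => ?_⟩, ?_⟩
  · have := (h (φ.symm '' e) (by rw [φ.symm.injective.encard_image, he])).image φ.injective
    rwa [φ.image_symm_image] at this
  · exact Set.ncard_image_of_injective _ φ.injective.image_injective

theorem exists_bootstrapClosure_ncard_eq_wsat (r n : ℕ) (H : Hypergraph α) :
    ∃ E : Set (Set (Fin n)), (∀ e ∈ E, e.encard = r) ∧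
      (∀ e : Set (Fin n), e.encard = r → BootstrapClosure H E e) ∧ E.ncard = wsat r n H := by
  obtain ⟨F, ⟨-, hF, h⟩, hcard⟩ := exists_isWeaklySaturated_ncard_eq_wsat r n H
  exact ⟨F.edgeSet, hF, fun e he => bootstrapClosure_of_reflTransGen h he, hcard⟩

/-! ### Lower bound -/

theorem exists_ne_edge_of_encard_lt_sparseness {H : Hypergraph α} {T U : Set α} {k : ℕ}
    (hk : k < sparseness H) (hT : T.encard = k) (hU : U ∈ H.edgeSet) (hTU : T ⊆ U) :
    ∃ U' ∈ H.edgeSet, U' ≠ U ∧ T ⊆ U' := by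
  by_contra! hcon
  refine Nat.notMem_of_lt_sInf hk ⟨T, hTU.trans (H.subset_vertexSet_of_mem_edgeSet' hU), hT, U,
    ⟨hU, hTU⟩, fun U' hU' => ?_⟩
  by_contra hne
  exact hcon U' hU'.1 hne hU'.2

theorem one_le_sparseness {H : Hypergraph α} {r : ℕ} (hH : H.IsUniform r)
    (hedges : 2 ≤ H.edgeSet.ncard) : 1 ≤ sparseness H := by
  obtain ⟨U₁, U₂, h₁, h₂, hne⟩ :=
    (Set.one_lt_ncard_iff (Set.finite_of_ncard_pos (by omega))).1 hedges
  obtain ⟨S, -, hS, U, hU, huniq⟩ := exists_encard_eq_sparseness r H hH ⟨U₁, h₁⟩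
  by_contra hlt
  have hS0 : S = ∅ := by
    rw [← Set.encard_eq_zero, hS]
    exact_mod_cast (by omega : sparseness H = 0)
  subst hS0
  exact hne ((huniq _ ⟨h₁, Set.empty_subset _⟩).trans (huniq _ ⟨h₂, Set.empty_subset _⟩).symm)

/-- Every set smaller than the sparseness that lies in a generated edge lies in a given edge. -/
theorem BootstrapClosure.exists_superset {H : Hypergraph α} {E : Set (Set β)} {e : Set β}
    (he : BootstrapClosure H E e) {T : Set β} {k : ℕ} (hk : k < sparseness H)
    (hT : T.encard = k) (hTe : T ⊆ e) : ∃ e' ∈ E, T ⊆ e' := by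
  induction he with
  | base he => exact ⟨_, he, hTe⟩
  | step f U hf hU _ ih =>
    obtain ⟨T', hT'U, rfl⟩ := Set.subset_image_iff.1 hTe
    have hV := H.subset_vertexSet_of_mem_edgeSet' hU
    rw [(hf.mono (hT'U.trans hV)).encard_image] at hT
    obtain ⟨U', hU', hne, hTU'⟩ := exists_ne_edge_of_encard_lt_sparseness hk hT hU hT'U
    exact ih U' hU' hne (Set.image_mono hTU')

theorem choose_le_wsat_mul_choose (H : Hypergraph α) {r n k : ℕ} (hk : k < sparseness H)
    (hkr : k ≤ r) (hrn : r ≤ n) : n.choose k ≤ wsat r n H * r.choose k := by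
  classical
  obtain ⟨E, hE, hcl, hcard⟩ := exists_bootstrapClosure_ncard_eq_wsat r n H
  have hEfin : E.Finite := Set.toFinite _
  have hsub : (Finset.univ : Finset (Fin n)).powersetCard k ⊆
      hEfin.toFinset.biUnion fun e => e.toFinset.powersetCard k := by
    intro T hT
    rw [Finset.mem_powersetCard] at hT
    obtain ⟨e, hTe, -, he⟩ := Finset.exists_subsuperset_card_eq (n := r) hT.1 (by omega)
      (by simpa using hrn)
    have he' : (e : Set (Fin n)).encard = r := by rw [Set.encard_coe_eq_coe_finsetCard, he]
    obtain ⟨e', he'E, hTe'⟩ := (hcl _ he').exists_superset (T := (T : Set (Fin n))) hk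
      (by rw [Set.encard_coe_eq_coe_finsetCard, hT.2]) (by exact_mod_cast hTe)
    simp only [Finset.mem_biUnion, Set.Finite.mem_toFinset, Finset.mem_powersetCard]
    exact ⟨e', he'E, fun x hx => by simpa using hTe' (by simpa using hx), hT.2⟩
  calc n.choose k = ((Finset.univ : Finset (Fin n)).powersetCard k).card := by simp
    _ ≤ _ := Finset.card_le_card hsub
    _ ≤ hEfin.toFinset.card * r.choose k := by
      refine Finset.card_biUnion_le_card_mul _ _ _ fun e he => ?_
      have := hE e (by simpa using he)
      rw [Finset.card_powersetCard, ← Set.ncard_eq_toFinset_card', Set.ncard_def, this]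
      simp
    _ = wsat r n H * r.choose k := by rw [← hcard, Set.ncard_eq_toFinset_card _ hEfin]

/-! ### Upper bound: reduction to a core -/

/-- A map carrying the edge `U` of `H` onto `e`, a prescribed part `S` of `U` outside the core `W`,
and the vertices outside `U` into the core. -/
theorem exists_injOn_image_eq [Nonempty β] {V U S : Set α} {W e : Set β} {r s : ℕ}
    (hV : V.Finite) (hUV : U ⊆ V) (hSU : S ⊆ U) (hU : U.encard = r) (hS : S.encard = s)
    (hVW : V.encard ≤ W.encard) (he : e.encard = r) (hs : (s : ℕ∞) ≤ (e \ W).encard) :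
    ∃ f : α → β, Set.InjOn f V ∧ f '' U = e ∧ f '' S ⊆ e \ W ∧ f '' (V \ U) ⊆ W := by
  classical
  obtain ⟨S', hS'e, hS'⟩ := Set.exists_subset_encard_eq hs
  have hS'e' : S' ⊆ e := hS'e.trans Set.sdiff_subset
  obtain ⟨f₁, h₁⟩ := (hV.subset (hSU.trans hUV)).exists_bijOn_of_encard_eq (hS.trans hS'.symm)
  have hcard₂ : (U \ S).encard = (e \ S').encard := by
    have h1 := Set.encard_sdiff_add_encard_of_subset hSU
    have h2 := Set.encard_sdiff_add_encard_of_subset hS'e'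
    rw [hS, hU] at h1
    rw [hS', he] at h2
    exact WithTop.add_right_cancel (ENat.natCast_ne_top s) (h1.trans h2.symm)
  obtain ⟨f₂, h₂⟩ := (hV.subset (Set.sdiff_subset.trans hUV)).exists_bijOn_of_encard_eq hcard₂
  have hcard₃ : (V \ U).encard ≤ (W \ e).encard := by
    have h1 := Set.encard_sdiff_add_encard_of_subset hUV
    have h2 := Set.encard_le_encard_sdiff_add_encard W e
    rw [hU] at h1
    rw [he] at h2
    exact (WithTop.add_le_add_iff_right (ENat.natCast_ne_top r)).1 (h1.le.trans (hVW.trans h2))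
  obtain ⟨f₃, h₃, hinj₃⟩ := (hV.subset Set.sdiff_subset).exists_injOn_of_encard_le hcard₃
  let f : α → β := S.piecewise f₁ (U.piecewise f₂ f₃)
  have e₁ : Set.EqOn f₁ f S := fun x hx => (Set.piecewise_eq_of_mem _ _ _ hx).symm
  have e₂ : Set.EqOn f₂ f (U \ S) := fun x hx => by
    simp [f, Set.piecewise_eq_of_notMem _ _ _ hx.2, Set.piecewise_eq_of_mem _ _ _ hx.1]
  have e₃ : Set.EqOn f₃ f (V \ U) := fun x hx => by
    simp [f, Set.piecewise_eq_of_notMem _ _ _ hx.2,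
      Set.piecewise_eq_of_notMem _ _ _ fun h => hx.2 (hSU h)]
  replace h₁ := h₁.congr e₁
  replace h₂ := h₂.congr e₂
  have h₃' : Set.MapsTo f (V \ U) (W \ e) := fun x hx => e₃ hx ▸ h₃ hx
  replace hinj₃ := hinj₃.congr e₃
  have hinjU : Set.InjOn f U := by
    rw [← Set.union_sdiff_cancel hSU, Set.injOn_union Set.disjoint_sdiff_right]
    exact ⟨h₁.injOn, h₂.injOn, fun a ha b hb hab => (h₂.mapsTo hb).2 (hab ▸ h₁.mapsTo ha)⟩
  have hfU : f '' U = e := by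
    have := h₁.union h₂ (by rwa [Set.union_sdiff_cancel hSU])
    rw [Set.union_sdiff_cancel hSU, Set.union_sdiff_cancel hS'e'] at this
    exact this.image_eq
  refine ⟨f, ?_, hfU, h₁.image_eq.subset.trans hS'e, ?_⟩
  · rw [← Set.union_sdiff_cancel hUV, Set.injOn_union Set.disjoint_sdiff_right]
    exact ⟨hinjU, hinj₃, fun a ha b hb hab =>
      (h₃' hb).2 (hfU ▸ hab ▸ Set.mem_image_of_mem f ha)⟩
  · rintro _ ⟨x, hx, rfl⟩
    exact (h₃' hx).1

/-- Once all `r`-sets with few vertices outside a large core are generated, all `r`-sets are. -/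
theorem bootstrapClosure_of_core [Nonempty β] {H : Hypergraph α} {r : ℕ} (hfin : H.vertexSet.Finite)
    (hH : H.IsUniform r) (hne : H.edgeSet.Nonempty) {E : Set (Set β)} {W : Set β}
    (hW : H.vertexSet.encard ≤ W.encard)
    (h : ∀ e : Set β, e.encard = r → (e \ W).encard < sparseness H → BootstrapClosure H E e)
    {e : Set β} (he : e.encard = r) : BootstrapClosure H E e := by
  induction hm : (e \ W).ncard using Nat.strong_induction_on generalizing e with
  | _ m ih =>
    have hefin : e.Finite := Set.finite_of_encard_eq_coe he
    by_cases hlt : (e \ W).encard < sparseness H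
    · exact h e he hlt
    obtain ⟨S, -, hS, U, ⟨hU, hSU⟩, huniq⟩ := exists_encard_eq_sparseness r H hH hne
    have hUV := H.subset_vertexSet_of_mem_edgeSet' hU
    obtain ⟨f, hf, hfU, hfS, hfV⟩ :=
      exists_injOn_image_eq hfin hUV hSU (hH U hU) hS hW he (not_lt.1 hlt)
    rw [← hfU]
    refine .step f U hf hU fun U' hU' hne' => ?_
    have hU'V := H.subset_vertexSet_of_mem_edgeSet' hU'
    -- Only `U` contains `S`, so `U'` misses some `a ∈ S`. Its image then loses the outer vertex `f
    -- a` and gains none, since vertices off `U` go into the core.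
    obtain ⟨a, haS, haU'⟩ := Set.not_subset.1 fun hc => hne' (huniq U' ⟨hU', hc⟩)
    refine ih _ ?_ (hH.encard_image hf hU') rfl
    rw [← hm]
    refine Set.ncard_lt_ncard ⟨?_, fun hc => ?_⟩ hefin.sdiff
    · rintro _ ⟨⟨x, hx, rfl⟩, hxW⟩
      refine ⟨?_, hxW⟩
      by_contra hxe
      refine hxW (hfV ⟨x, ⟨hU'V hx, fun hxU => hxe ?_⟩, rfl⟩)
      exact hfU ▸ Set.mem_image_of_mem f hxU
    · obtain ⟨⟨x, hx, hxa⟩, -⟩ := hc (hfS ⟨a, haS, rfl⟩)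
      exact haU' (hf (hU'V hx) (hUV (hSU haS)) hxa ▸ hx)

/-! ### Transversal designs over `ZMod q` -/

open Polynomial in
/-- Polynomial interpolation at nodes whose pairwise differences are units. -/
theorem exists_mem_degreeLT_eval_eq {R ι : Type*} [CommRing R] (A : Finset ι) (x y : ι → R)
    (h : ∀ i ∈ A, ∀ j ∈ A, i ≠ j → IsUnit (x i - x j)) :
    ∃ p ∈ degreeLT R A.card, ∀ i ∈ A, p.eval (x i) = y i := by
  classical
  induction A using Finset.induction_on with
  | empty => exact ⟨0, zero_mem _, by simp⟩
  | insert a A ha ih =>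
    obtain ⟨p, hp, hpA⟩ := ih fun i hi j hj =>
      h i (Finset.mem_insert_of_mem hi) j (Finset.mem_insert_of_mem hj)
    have hunit : IsUnit (∏ i ∈ A, (x a - x i)) := by
      rw [IsUnit.prod_iff]
      exact fun i hi => h a (Finset.mem_insert_self _ _) i (Finset.mem_insert_of_mem hi)
        fun hai => ha (hai ▸ hi)
    obtain ⟨u, hu⟩ := hunit
    -- Newton's correction: the added term vanishes at the old nodes and repairs the value at `x a`.
    refine ⟨p + C ((y a - p.eval (x a)) * ↑u⁻¹) * ∏ i ∈ A, (X - C (x i)), ?_, ?_⟩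
    · rw [Finset.card_insert_of_notMem ha]
      refine add_mem (degreeLT_mono (Nat.le_succ _) hp) ?_
      rw [← smul_eq_C_mul]
      refine Submodule.smul_mem _ _ ?_
      rw [mem_degreeLT]
      refine lt_of_le_of_lt (b := (A.card : WithBot ℕ)) ?_ (by exact_mod_cast Nat.lt_succ_self _)
      refine (degree_prod_le _ _).trans ((Finset.sum_le_card_nsmul _ _ 1 fun i _ =>
        degree_X_sub_C_le _).trans (by simp))
    · intro i hi
      rw [eval_add, eval_mul, eval_C, eval_prod]
      simp only [eval_sub, eval_X, eval_C]
      rcases Finset.mem_insert.1 hi with rfl | hi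
      · rw [← hu, mul_assoc, Units.inv_mul]
        ring
      · rw [Finset.prod_eq_zero hi (sub_self _), hpA i hi]
        ring

theorem isUnit_natCast_sub_natCast {q k : ℕ} (hq : ∀ d, 0 < d → d < k → d.Coprime q) {i j : ℕ}
    (hi : i < k) (hj : j < k) (hij : i ≠ j) : IsUnit ((i : ZMod q) - j) := by
  rcases lt_or_gt_of_ne hij with h | h
  · rw [← neg_sub, IsUnit.neg_iff, ← Nat.cast_sub h.le]
    exact (ZMod.isUnit_iff_coprime _ _).2 (hq _ (by omega) (by omega))
  · rw [← Nat.cast_sub h.le]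
    exact (ZMod.isUnit_iff_coprime _ _).2 (hq _ (by omega) (by omega))

/-- A transversal design on part of a `k × q` grid: at most `q ^ t` blocks of size `k` cover all
sets of at most `t` points in distinct groups. -/
theorem exists_transversal_cover (t : ℕ) {k q N : ℕ} [NeZero q] (hkN : k ≤ N)
    (hq : ∀ d, 0 < d → d < k → d.Coprime q) (hN : N ≤ k * q) :
    ∃ (φ : Fin N → Fin k × ZMod q) (B : (Fin t → ZMod q) → Finset (Fin N)),
      Function.Injective φ ∧ (∀ c, (B c).card = k) ∧
      ∀ A : Finset (Fin N), A.card ≤ t → Set.InjOn (fun x => (φ x).1) A → ∃ c, A ⊆ B c := by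
  obtain ⟨φ⟩ : Nonempty (Fin N ↪ Fin k × ZMod q) :=
    Function.Embedding.nonempty_of_card_le (by simpa [ZMod.card] using hN)
  let B₀ : (Fin t → ZMod q) → Finset (Fin N) := fun c =>
    {x | (φ x).2 = ∑ j, c j * (((φ x).1 : ℕ) : ZMod q) ^ (j : ℕ)}
  -- A graph meets each group at most once, but may lose grid points not hit by `φ`; it is padded to
  -- size exactly `k`.
  have hB₀ : ∀ c, ∃ B, B₀ c ⊆ B ∧ B.card = k := fun c => by
    refine Finset.exists_superset_card_eq ?_ (by simpa using hkN)
    have hinj : Set.InjOn (fun x => (φ x).1) (B₀ c : Set (Fin N)) := by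
      intro x hx y hy hxy
      simp only [B₀, Finset.coe_filter, Finset.mem_univ, true_and, Set.mem_ofPred_eq] at hx hy
      exact φ.injective (Prod.ext hxy (by rw [hx, hy]; simp only at hxy; rw [hxy]))
    simpa using Finset.card_le_card_of_injOn (t := Finset.univ) _ (by simp) hinj
  choose B hB hBcard using hB₀
  refine ⟨φ, B, φ.injective, hBcard, fun A hA hinj => ?_⟩
  obtain ⟨p, hp, hpA⟩ := exists_mem_degreeLT_eval_eq A
    (fun x => (((φ x).1 : ℕ) : ZMod q)) (fun x => (φ x).2) fun i hi j hj hij =>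
      isUnit_natCast_sub_natCast hq (φ i).1.2 (φ j).1.2 fun h => hij (hinj hi hj (Fin.ext h))
  have hp' := Polynomial.degreeLT_mono hA hp
  refine ⟨Polynomial.degreeLTEquiv _ _ ⟨p, hp'⟩, fun x hx => hB _ ?_⟩
  simp only [B₀, Finset.mem_filter, Finset.mem_univ, true_and]
  rw [← hpA x hx, Polynomial.eval_eq_sum_degreeLTEquiv hp']

theorem exists_range_eq_of_ncard_le [Finite β] {D : Set β} {m : ℕ} (hD : D.Nonempty)
    (h : D.ncard ≤ m) : ∃ f : Fin m → β, Set.range f = D := by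
  classical
  have := Fintype.ofFinite β
  obtain ⟨g⟩ : Nonempty (D ↪ Fin m) := Function.Embedding.nonempty_of_card_le (by
    rwa [Fintype.card_fin, ← Nat.card_eq_fintype_card, Nat.card_coe_set_eq])
  have := hD.to_subtype
  refine ⟨Subtype.val ∘ Function.invFun g, ?_⟩
  rw [Set.range_comp, (Function.invFun_surjective g.injective).range_eq, Set.image_univ,
    Subtype.range_coe]

/-- Few sets contain at most `t` points of the right summand, two of them in the same group. -/
theorem ncard_nontransversal_le {v N k q t : ℕ} [NeZero q] {φ : Fin N → Fin k × ZMod q}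
    (hφ : Function.Injective φ) :
    {e : Set (Fin v ⊕ Fin N) | (Sum.inr ⁻¹' e).ncard ≤ t ∧
      ¬ Set.InjOn (fun x => (φ x).1) (Sum.inr ⁻¹' e)}.ncard ≤
    2 ^ v * (N ^ (t - 1) * ((t - 1) * q)) := by
  classical
  rcases N.eq_zero_or_pos with rfl | hNpos
  · simp
  have : Nonempty (Fin N) := ⟨⟨0, hNpos⟩⟩
  -- Encoding of a bad set: its core part, a list of its outer points other than `y`, the index of
  -- one in the group of `y`, and the position of `y` in that group.
  let F : Set (Fin v) × (Fin (t - 1) → Fin N) × Fin (t - 1) × ZMod q → Set (Fin v ⊕ Fin N) :=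
    fun p => Sum.inl '' p.1 ∪
      Sum.inr '' insert (Function.invFun φ ((φ (p.2.1 p.2.2.1)).1, p.2.2.2)) (Set.range p.2.1)
  have hcard : (Set.range F).ncard ≤ 2 ^ v * (N ^ (t - 1) * ((t - 1) * q)) := by
    rw [← Set.image_univ]
    refine (Set.ncard_image_le Set.finite_univ).trans ?_
    rw [Set.ncard_univ]
    simp [ZMod.card]
  refine (Set.ncard_le_ncard (fun e he => ?_) (Set.toFinite _)).trans hcard
  obtain ⟨ht, hne⟩ := he
  obtain ⟨x, hx, y, hy, hxy, hne⟩ : ∃ x, Sum.inr x ∈ e ∧ ∃ y, Sum.inr y ∈ e ∧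
      (φ x).1 = (φ y).1 ∧ x ≠ y := by
    simpa [Set.InjOn] using hne
  have hxD : x ∈ (Sum.inr ⁻¹' e : Set (Fin N)) \ {y} := ⟨hx, hne⟩
  obtain ⟨f, hf⟩ := exists_range_eq_of_ncard_le (m := t - 1) ⟨x, hxD⟩ (by
    rw [Set.ncard_sdiff_singleton_of_mem (show y ∈ (Sum.inr ⁻¹' e : Set (Fin N)) from hy)]
    omega)
  obtain ⟨i, rfl⟩ : x ∈ Set.range f := hf ▸ hxD
  refine ⟨(Sum.inl ⁻¹' e, f, i, (φ y).2), ?_⟩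
  have hy' : Function.invFun φ ((φ (f i)).1, (φ y).2) = y := by
    rw [hxy]
    exact Function.leftInverse_invFun hφ y
  simp only [F, hy', hf, Set.insert_sdiff_singleton, Set.insert_eq_of_mem
    (show y ∈ (Sum.inr ⁻¹' e : Set (Fin N)) from hy)]
  exact Set.image_preimage_inl_union_image_preimage_inr e

/-! ### Gluing optimal systems along blocks, and the limit -/

theorem wsat_add_le {H : Hypergraph α} {r t : ℕ} (hfin : H.vertexSet.Finite)
    (hH : H.IsUniform r) (hne : H.edgeSet.Nonempty) (ht : sparseness H = t + 1) {k q N : ℕ}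
    (hk : 0 < k) (hkN : k ≤ N) (hq : ∀ d, 0 < d → d < k → d.Coprime q) (hN : N ≤ k * q) :
    wsat r (H.vertexSet.ncard + N) H ≤ q ^ t * wsat r (H.vertexSet.ncard + k) H +
      2 ^ H.vertexSet.ncard * (N ^ (t - 1) * ((t - 1) * q)) := by
  have : NeZero q := ⟨by rintro rfl; omega⟩
  have : Nonempty (Fin N) := ⟨⟨0, by omega⟩⟩
  set v := H.vertexSet.ncard with hv
  obtain ⟨φ, B, hφ, hB, hcover⟩ := exists_transversal_cover t hkN hq hN
  obtain ⟨E₀, hE₀, hcl, hcard⟩ := exists_bootstrapClosure_ncard_eq_wsat r (v + k) H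
  let G : (Fin t → ZMod q) → Fin (v + k) → Fin v ⊕ Fin N := fun c =>
    Sum.map id ((B c).orderEmbOfFin (hB c)) ∘ finSumFinEquiv.symm
  have hG : ∀ c, Function.Injective (G c) := fun c =>
    (Function.injective_id.sumMap ((B c).orderEmbOfFin (hB c)).injective).comp
      finSumFinEquiv.symm.injective
  have hGrange : ∀ c, Set.range (G c) = Set.range Sum.inl ∪ Sum.inr '' (B c : Set (Fin N)) := by
    intro c
    have h := Set.ext_iff.1 (Finset.range_orderEmbOfFin (B c) (hB c))
    rw [finSumFinEquiv.symm.surjective.range_comp]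
    ext (x | x)
    · simp
    · rw [Set.mem_range, Set.mem_union, Set.mem_range, Set.mem_image]
      simp only [Sum.exists, Sum.map_inl, Sum.map_inr, reduceCtorEq, exists_false, false_or,
        Sum.inr.injEq, exists_eq_right]
      exact h x
  let bad : Set (Set (Fin v ⊕ Fin N)) := {e | (Sum.inr ⁻¹' e).ncard ≤ t ∧
      ¬ Set.InjOn (fun x => (φ x).1) (Sum.inr ⁻¹' e)}
  let E : Set (Set (Fin v ⊕ Fin N)) :=
    (⋃ c, Set.image (G c) '' E₀) ∪ {e ∈ bad | e.encard = r}
  have hEcard : E.ncard ≤ q ^ t * wsat r (v + k) H +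
      2 ^ v * (N ^ (t - 1) * ((t - 1) * q)) := by
    refine (Set.ncard_union_le _ _).trans (Nat.add_le_add ?_ ?_)
    · refine (Set.ncard_iUnion_le_of_fintype _).trans ((Finset.sum_le_card_nsmul _ _
        (wsat r (v + k) H) fun c _ => ?_).trans (by simp [ZMod.card]))
      rw [← hcard]
      exact Set.ncard_image_le (Set.toFinite _)
    · exact (Set.ncard_le_ncard (Set.sep_subset _ _) (Set.toFinite _)).trans
        (ncard_nontransversal_le hφ)
  refine (wsat_le_ncard hH finSumFinEquiv E ?_ fun e he =>
    bootstrapClosure_of_core hfin hH hne (W := Set.range Sum.inl) ?_ ?_ he).trans hEcard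
  · rintro e (he | he)
    · obtain ⟨c, e', he', rfl⟩ := Set.mem_iUnion.1 he
      rw [(hG c).encard_image, hE₀ e' he']
    · exact he.2
  · rw [← Set.image_univ, Sum.inl_injective.encard_image, Set.encard_univ, ← hfin.cast_ncard_eq]
    simp [hv]
  · intro e he hlt
    have hdiff : e \ Set.range Sum.inl = Sum.inr '' (Sum.inr ⁻¹' e) := by
      ext (x | x) <;> simp
    rw [hdiff, Sum.inr_injective.encard_image, ht, ← Set.Finite.cast_ncard_eq (Set.toFinite _)] at hlt
    have hle : (Sum.inr ⁻¹' e : Set (Fin N)).ncard ≤ t := Nat.lt_succ_iff.1 (by exact_mod_cast hlt)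
    by_cases hinj : Set.InjOn (fun x => (φ x).1) (Sum.inr ⁻¹' e)
    · obtain ⟨c, hc⟩ := hcover (Set.toFinite (Sum.inr ⁻¹' e : Set (Fin N))).toFinset
        (by rwa [← Set.ncard_eq_toFinset_card]) (by simpa using hinj)
      have hsub : e ⊆ Set.range (G c) := by
        rw [hGrange]
        rintro (x | x) hx
        · exact Or.inl ⟨x, rfl⟩
        · exact Or.inr ⟨x, hc (by simpa using hx), rfl⟩
      rw [← Set.image_preimage_eq_of_subset hsub] at he ⊢
      rw [(hG c).encard_image] at he
      exact ((hcl _ he).image (hG c)).mono ((Set.subset_iUnion (fun c => Set.image (G c) '' E₀)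
        c).trans Set.subset_union_left)
    · exact .base (Or.inr ⟨⟨hle, hinj⟩, he⟩)

section

open Filter Topology

/-- A form of Fekete's lemma for sequences that are nearly minimal along every subsequence. -/
theorem exists_tendsto_of_eventually_le {a : ℕ → ℝ} {b : ℕ → ℕ → ℝ} {D : ℝ} (hD : 0 ≤ D)
    (ha : ∀ n, 0 ≤ a n) (hab : ∀ k, 0 < k → ∀ᶠ n in atTop, a n ≤ b k n)
    (hb : ∀ k, 0 < k → Tendsto (b k) atTop (𝓝 (a k + D / k))) :
    ∃ L, Tendsto a atTop (𝓝 L) := by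
  -- The limit is the infimum of `a k + D / k`; the lower estimate holds because `D / n` tends to 0.
  let S : Set ℝ := (fun k : ℕ => a k + D / k) '' Set.Ioi 0
  have hS : BddBelow S := ⟨0, by
    rintro _ ⟨k, -, rfl⟩
    have := ha k
    positivity⟩
  refine ⟨sInf S, tendsto_order.2 ⟨fun l hl => ?_, fun u hu => ?_⟩⟩
  · have hlim : Tendsto (fun n : ℕ => D / (n : ℝ)) atTop (𝓝 0) :=
      tendsto_const_div_atTop_nhds_zero_nat D
    filter_upwards [hlim.eventually_lt_const (sub_pos.2 hl), eventually_gt_atTop 0] with n hn hpos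
    have := csInf_le hS ⟨n, hpos, rfl⟩
    simp only at this
    linarith
  · obtain ⟨_, ⟨k, hk, rfl⟩, hku⟩ := exists_lt_of_csInf_lt
      (Set.Nonempty.image _ ⟨1, Nat.one_pos⟩ : S.Nonempty) hu
    filter_upwards [hab k hk, (hb k hk).eventually_lt_const hku] with n h1 h2
    exact h1.trans_lt h2

/-- An integer just above `N / k` that is coprime to all positive integers below `k`. -/
theorem exists_coprime_near_div {k : ℕ} (hk : 0 < k) (N : ℕ) :
    ∃ q : ℕ, (∀ d, 0 < d → d < k → d.Coprime q) ∧ N ≤ k * q ∧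
      (q : ℝ) ≤ N / k + (k.factorial + 1) := by
  -- Any `q` congruent to 1 modulo `k!` is coprime to every positive `d < k`.
  refine ⟨k.factorial * (N / (k * k.factorial) + 1) + 1, fun d hd hdk => ?_, ?_, ?_⟩
  · refine Nat.Coprime.coprime_dvd_left (Nat.dvd_factorial hd hdk.le) ?_
    simp
  · have := Nat.lt_mul_div_succ N (Nat.mul_pos hk k.factorial_pos)
    nlinarith
  · have h1 : ((N / (k * k.factorial) : ℕ) : ℝ) ≤ N / (k * k.factorial : ℕ) := Nat.cast_div_le
    have h2 : (0 : ℝ) < k.factorial := by exact_mod_cast k.factorial_pos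
    have h3 : (k.factorial : ℝ) * (N / (k * k.factorial : ℕ)) = N / k := by
      push_cast
      field_simp
    have h4 := mul_le_mul_of_nonneg_left h1 h2.le
    push_cast at h3 h4 ⊢
    linarith

theorem exists_tendsto_wsat_div_pow {H : Hypergraph α} {r t : ℕ} (hfin : H.vertexSet.Finite)
    (hH : H.IsUniform r) (hne : H.edgeSet.Nonempty) (ht : sparseness H = t + 1) :
    ∃ L : ℝ, Tendsto (fun N : ℕ => (wsat r (H.vertexSet.ncard + N) H : ℝ) / (N : ℝ) ^ t) atTop
      (𝓝 L) := by
  set v := H.vertexSet.ncard with hv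
  let D : ℝ := 2 ^ v * ((t - 1 : ℕ) : ℝ)
  -- Upper bound for `q / N`, tending to `1 / k`.
  let x : ℕ → ℕ → ℝ := fun k N => 1 / k + (k.factorial + 1) / N
  refine exists_tendsto_of_eventually_le (D := D)
    (b := fun k N => x k N ^ t * wsat r (v + k) H + D * x k N) (by positivity)
    (fun n => by positivity) (fun k hk => ?_) fun k hk => ?_
  · filter_upwards [eventually_ge_atTop k] with N hN
    have hN0 : (0 : ℝ) < N := by exact_mod_cast hk.trans_le hN
    obtain ⟨q, hq, hNq, hqle⟩ := exists_coprime_near_div hk N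
    have hle : (wsat r (v + N) H : ℝ) ≤ q ^ t * wsat r (v + k) H +
        2 ^ v * (N ^ (t - 1) * (((t - 1 : ℕ) : ℝ) * q)) := by
      exact_mod_cast wsat_add_le hfin hH hne ht hk hN hq hNq
    have hqx : (q : ℝ) ≤ x k N * N := hqle.trans_eq (by simp only [x]; field_simp)
    have hpow : (N : ℝ) ^ (t - 1) * (((t - 1 : ℕ) : ℝ) * N) = N ^ t * ((t - 1 : ℕ) : ℝ) := by
      -- For `t = 0` truncated subtraction makes both sides zero.
      cases t with
      | zero => simp
      | succ t => simp only [Nat.add_sub_cancel]; ring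
    rw [div_le_iff₀ (by positivity)]
    calc (wsat r (v + N) H : ℝ) ≤ _ := hle
      _ ≤ (x k N * N) ^ t * wsat r (v + k) H +
          2 ^ v * (N ^ (t - 1) * (((t - 1 : ℕ) : ℝ) * (x k N * N))) := by gcongr
      _ = (x k N * N) ^ t * wsat r (v + k) H +
          2 ^ v * x k N * (N ^ (t - 1) * (((t - 1 : ℕ) : ℝ) * N)) := by ring
      _ = _ := by rw [hpow, mul_pow]; simp only [D]; ring
  · have hx : Tendsto (x k) atTop (𝓝 (1 / k)) := by
      simpa [x] using (tendsto_const_nhds (x := (1 / k : ℝ))).add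
        (tendsto_const_div_atTop_nhds_zero_nat ((k.factorial : ℝ) + 1))
    convert ((hx.pow t).mul_const (wsat r (v + k) H : ℝ)).add (hx.const_mul D) using 2
    rw [div_pow, one_pow]
    ring

theorem tendsto_choose_div_pow (t : ℕ) :
    Tendsto (fun N : ℕ => (N.choose t : ℝ) / (N : ℝ) ^ t) atTop (𝓝 (1 / t.factorial)) := by
  have hne : ∀ᶠ n : ℕ in atTop, (n : ℝ) ^ t / t.factorial ≠ 0 := by
    filter_upwards [eventually_gt_atTop 0] with n hn
    positivity
  have h := (Asymptotics.isEquivalent_iff_tendsto_one hne).1 (isEquivalent_choose t)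
  refine (one_mul (1 / (t.factorial : ℝ)) ▸ h.mul_const (1 / (t.factorial : ℝ))).congr fun n => ?_
  simp only [Pi.div_apply]
  field_simp

end

end Hypergraph

open Filter Topology Hypergraph in
theorem mainTheorem1 {α : Type*} (r : ℕ) (H : Hypergraph α)
    (hfin : H.vertexSet.Finite) (hunif : H.IsUniform r) (hedges : 2 ≤ H.edgeSet.ncard) :
    1 ≤ H.sparseness ∧
    (∃ C : ℝ, 0 < C ∧
      Asymptotics.IsEquivalent Filter.atTop
        (fun n : ℕ => (Hypergraph.wsat r n H : ℝ))
        (fun n : ℕ => C * (n : ℝ) ^ (H.sparseness - 1))) ∧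
    (∃ L : ℝ, Filter.Tendsto
      (fun n : ℕ => (Hypergraph.wsat r n H : ℝ) /
        ((n - H.vertexSet.ncard).choose (H.sparseness - 1) : ℝ))
      Filter.atTop (nhds L)) := by
  have hs := one_le_sparseness hunif hedges
  have hne : H.edgeSet.Nonempty := Set.nonempty_of_ncard_ne_zero (by omega)
  obtain ⟨t, ht⟩ : ∃ t, H.sparseness = t + 1 := ⟨_, (Nat.sub_add_cancel hs).symm⟩
  have htr : t ≤ r := by
    obtain ⟨S, -, hS, U, ⟨hU, hSU⟩, -⟩ := exists_encard_eq_sparseness r H hunif hne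
    have := Set.encard_le_encard hSU
    rw [hS, hunif U hU, ht] at this
    have : t + 1 ≤ r := by exact_mod_cast this
    omega
  obtain ⟨L, hL⟩ := exists_tendsto_wsat_div_pow hfin hunif hne ht
  have hchoose := tendsto_choose_div_pow t
  have hrpos : (0 : ℝ) < r.choose t := by exact_mod_cast Nat.choose_pos htr
  have hfac : (0 : ℝ) < t.factorial := by exact_mod_cast t.factorial_pos
  have hLpos : 0 < L := by
    -- The covering bound gives `L ≥ 1 / (t! * r.choose t)`.
    refine lt_of_lt_of_le (by positivity) (le_of_tendsto_of_tendsto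
      (hchoose.div_const (r.choose t : ℝ)) hL ?_)
    filter_upwards [eventually_ge_atTop r] with N hN
    rw [div_right_comm]
    refine div_le_div_of_nonneg_right ((div_le_iff₀ hrpos).2 ?_) (by positivity)
    refine le_trans (Nat.cast_le.2 (Nat.choose_le_choose t (Nat.le_add_left N H.vertexSet.ncard))) ?_
    exact_mod_cast choose_le_wsat_mul_choose H (by omega) htr
      (hN.trans (Nat.le_add_left N H.vertexSet.ncard))
  rw [ht, Nat.add_sub_cancel]
  refine ⟨by omega, ⟨L, hLpos, ?_⟩, L / (1 / t.factorial), ?_⟩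
  · refine Asymptotics.isEquivalent_of_tendsto_one ?_
    rw [← tendsto_add_atTop_iff_nat H.vertexSet.ncard]
    have hshift := (tendsto_natCast_div_add_atTop (H.vertexSet.ncard : ℝ)).pow t
    have hlim := (hL.div_const L).mul hshift
    rw [div_self hLpos.ne', one_pow, one_mul] at hlim
    refine hlim.congr' ?_
    filter_upwards [eventually_gt_atTop 0] with N hN
    have : (0 : ℝ) < N := by exact_mod_cast hN
    rw [Pi.div_apply, add_comm N, add_comm (N : ℝ), div_pow]
    push_cast
    field_simp
  · rw [← tendsto_add_atTop_iff_nat H.vertexSet.ncard]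
    refine (hL.div hchoose (by positivity)).congr' ?_
    filter_upwards [eventually_gt_atTop 0] with N hN
    have : (0 : ℝ) < N := by exact_mod_cast hN
    simp only [Pi.div_apply, Nat.add_sub_cancel_left, add_comm N]
    rw [div_div_div_cancel_right₀ (by positivity)]
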